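/- Let $L\ge 1$, let $0<\alpha_M<\alpha_Q$, and for $\ell=1,\dots,L$ let $\mu_{M,\ell},\mu_{Q,\ell},\Omega_{M,\ell},\Omega_{Q,\ell}>0$. For $a\in\{M,Q\}$, the $\bar\alpha$-$\bar\mu$ distribution with parameters $(\alpha_a,\mu_{a,\ell},\Omega_{a,\ell})$ is the distribution on $(0,\infty)$ with density $$x\mapsto \frac{\alpha_a\,\mu_{a,\ell}^{\mu_{a,\ell}}\,x^{\alpha_a\mu_{a,\ell}-1}}{\Omega_{a,\ell}^{\alpha_a\mu_{a,\ell}}\,\Gamma(\mu_{a,\ell})}\exp\!\Big(-\mu_{a,\ell}\frac{x^{\alpha_a}}{\Omega_{a,\ell}^{\alpha_a}}\Big),\qquad x>0 .$$ For each $\ell$ let $M_\ell$ and $Q_\ell$ be independent random variables having the $\bar\alpha$-$\bar\mu$ distributions with parameters $(\alpha_M,\mu_{M,\ell},\Omega_{M,\ell})$ and $(\alpha_Q,\mu_{Q,\ell},\Omega_{Q,\ell})$, put $Z_\ell=M_\ell/Q_\ell$, and suppose that $Z_1,\dots,Z_L$ are independent (not necessarily identically distributed). Put $Z=\sum_{\ell=1}^L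 Z_\ell$ and $$\tilde\varrho_\ell=\frac{\Omega_{Q,\ell}\,\mu_{M,\ell}^{1/\alpha_M}}{\Omega_{M,\ell}\,\mu_{Q,\ell}^{1/\alpha_Q}},\qquad u_{i,\ell}=\frac{(-1)^i}{i!}\,\Gamma\big(\alpha_M(i+\mu_{M,\ell})\big)\,\Gamma\Big(\frac{\alpha_M(i+\mu_{M,\ell})}{\alpha_Q}+\mu_{Q,\ell}\Big)\,\tilde\varrho_\ell^{\,\alpha_M(\mu_{M,\ell}+i)}\quad(i\ge 0).$$ Define $$\phi_{0,\ell}=\frac{u_{1,\ell}}{u_{0,\ell}},\qquad \phi_{h,\ell}=\frac1{u_{0,\ell}}\Big[(h+1)u_{h+1,\ell}-\sum_{t=1}^h u_{t,\ell}\,\phi_{h-t,\ell}\Big]\quad(h\ge1),$$ $$\delta_0=\prod_{\ell=1}^L u_{0,\ell},\qquad \delta_i=\frac1i\sum_{h=1}^i\delta_{i-h}\sum_{\ell=1}^L\phi_{h-1,\ell}\quad(i\ge1).$$ Then the following hold, all the series being absolutely convergent. (a) Each $Z_\ell$ has the density $$f_{Z_\ell}(z)=\frac{\alpha_M}{z\,\Gamma(\mu_{M,\ell})\Gamma(\mu_{Q,\ell})}\sum_{i=0}^\infty\frac{(-1)^i}{i!}(\tilde\varrho_\ell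 z)^{\alpha_M(i+\mu_{M,\ell})}\,\Gamma\Big(\frac{\alpha_M(i+\mu_{M,\ell})}{\alpha_Q}+\mu_{Q,\ell}\Big)\quad(z>0),\qquad f_{Z_\ell}(z)=0\quad(z\le 0).$$ (b) For every $\ell$ and every $\varepsilon>0$, $\displaystyle\lim_{i\to\infty}\frac{|u_{i,\ell}|}{\Gamma(i\alpha_M+\varepsilon)}=0$. (c) $Z$ has the density $$f_Z(z)=\Big(\prod_{\ell=1}^L\frac{\alpha_M}{\Gamma(\mu_{M,\ell})\Gamma(\mu_{Q,\ell})}\Big)\sum_{i=0}^\infty\frac{\delta_i\,z^{-1+i\alpha_M+\alpha_M\sum_{\ell=1}^L\mu_{M,\ell}}}{\Gamma\big(i\alpha_M+\alpha_M\sum_{\ell=1}^L\mu_{M,\ell}\big)}\quad(z>0),\qquad f_Z(z)=0\quad(z\le0).$$ (d) The distribution function of $Z$ is $$F_Z(z)=\Big(\prod_{\ell=1}^L\frac{\alpha_M}{\Gamma(\mu_{M,\ell})\Gamma(\mu_{Q,\ell})}\Big)\sum_{i=0}^\infty\frac{\delta_i\,z^{i\alpha_M+\alpha_M\sum_{\ell=1}^L\mu_{M,\ell}}}{\Gamma\big(1+i\alpha_M+\alpha_M\sum_{\ell=1}^L\mu_{M,\ell}\big)}\quad(z\ge0).$$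 -/

import Mathlib

namespace FadingSum

open MeasureTheory

/-- `f` is a probability density function (with respect to Lebesgue measure) of the law `ν`. -/
def IsPDF (ν : Measure ℝ) (f : ℝ → ℝ) : Prop :=
  Measurable f ∧ (∀ x, 0 ≤ f x) ∧ ν = volume.withDensity (fun x => ENNReal.ofReal (f x))

/-- The density of the `ᾱ-μ̄` distribution with nonlinearity parameter `α`, number of clusters `μ`
and `α`-root mean value `Ω`; it vanishes off the positive half-line. -/
noncomputable def alphaMuPDF (α μ Ω : ℝ) (x : ℝ) : ℝ :=
  (Set.Ioi (0 : ℝ)).indicator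
    (fun x => α * μ ^ μ * x ^ (α * μ - 1) / (Ω ^ (α * μ) * Real.Gamma μ)
      * Real.exp (-(μ * (x ^ α / Ω ^ α)))) x

/-- The `ᾱ-μ̄` distribution, as a measure on `ℝ`. -/
noncomputable def alphaMuLaw (α μ Ω : ℝ) : Measure ℝ :=
  volume.withDensity (fun x => ENNReal.ofReal (alphaMuPDF α μ Ω x))

/-- The coefficients `φ_h` built from a sequence `η`:
`φ_0 = η_1 / η_0` and `φ_h = η_0⁻¹ [(h+1) η_{h+1} - ∑_{t=1}^h η_t φ_{h-t}]` for `h ≥ 1`.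
In the second clause `h` stands for `h - 1` and `t` for `t - 1`. -/
noncomputable def phi (η : ℕ → ℝ) : ℕ → ℝ
  | 0 => η 1 / η 0
  | h + 1 => 1 / η 0 * (((h : ℝ) + 2) * η (h + 2)
      - ∑ t : Fin (h + 1), η ((t : ℕ) + 1) * phi η (h - (t : ℕ)))
  decreasing_by omega

/-- The coefficients `δ_i` built from sequences `η_1, …, η_L`:
`δ_0 = ∏_ℓ η_{0,ℓ}` and `δ_i = i⁻¹ ∑_{h=1}^i δ_{i-h} ∑_ℓ φ_{h-1,ℓ}` for `i ≥ 1`.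
In the second clause `i` stands for `i - 1` and `h` for `h - 1`. -/
noncomputable def delta {L : ℕ} (η : Fin L → ℕ → ℝ) : ℕ → ℝ
  | 0 => ∏ l, η l 0
  | i + 1 => 1 / ((i : ℝ) + 1) *
      ∑ h : Fin (i + 1), delta η (i - (h : ℕ)) * ∑ l, phi (η l) (h : ℕ)
  decreasing_by omega

/-- The `i`-th term of the series for the density of the sum (without the factor `∏ Ψ_ℓ`). -/
noncomputable def pdfTerm {L : ℕ} (θ : ℝ) (β : Fin L → ℝ) (η : Fin L → ℕ → ℝ)
    (x : ℝ) (i : ℕ) : ℝ :=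
  delta η i * x ^ (-1 + θ * i + ∑ l, β l) / Real.Gamma (i * θ + ∑ l, β l)

/-- The `i`-th term of the series for the distribution function of the sum
(without the factor `∏ Ψ_ℓ`). -/
noncomputable def cdfTerm {L : ℕ} (θ : ℝ) (β : Fin L → ℝ) (η : Fin L → ℕ → ℝ)
    (x : ℝ) (i : ℕ) : ℝ :=
  delta η i * x ^ (θ * i + ∑ l, β l) / Real.Gamma (1 + i * θ + ∑ l, β l)

/-- The scale `ϱ̃` of a ratio of `ᾱ-μ̄` variates. -/
noncomputable def rhoTilde (αM αQ μM μQ ΩM ΩQ : ℝ) : ℝ :=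
  ΩQ * μM ^ (1 / αM) / (ΩM * μQ ^ (1 / αQ))

/-- The coefficients `u_i` of a ratio of `ᾱ-μ̄` variates, with `ϱ = ϱ̃`. -/
noncomputable def u (αM αQ μM μQ ϱ : ℝ) (i : ℕ) : ℝ :=
  (-1) ^ i * Real.Gamma (αM * (i + μM)) * Real.Gamma (αM * (i + μM) / αQ + μQ)
    * ϱ ^ (αM * (μM + i)) / (i.factorial : ℝ)

/-- The `i`-th term of the series for the density of one ratio
(without the factor `αM / (z Γ(μM) Γ(μQ))`), with `ϱ = ϱ̃`. -/
noncomputable def ratioTerm (αM αQ μM μQ ϱ : ℝ) (z : ℝ) (i : ℕ) : ℝ :=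
  (-1) ^ i / (i.factorial : ℝ) * (ϱ * z) ^ (αM * (i + μM))
    * Real.Gamma (αM * (i + μM) / αQ + μQ)

end FadingSum

namespace FadingSum

open MeasureTheory Finset

/-! ### The recursive coefficients as a product of power series -/

/-! The functions `x ^ (s - 1) / Γ(s)` form a convolution semigroup in `s`: this is Euler's beta
integral. If each summand has density `∑ aᵢ x ^ (θ i + β - 1) / Γ(θ i + β)`, the sum therefore has a
density of the same shape, with the `β`s added and the coefficient sequences Cauchy-multiplied
(`lconvolution_gammaSeries`). This is multiplication of Laplace transforms, done directly on the
densities.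

The recursions for `φ` and `δ` compute that product of power series through its logarithmic
derivative (`delta_eq_coeff`). A ratio density has the required shape: expand the exponential of the
numerator density and integrate termwise against the denominator (`lintegral_alphaMuPDF_mul`).

Convergence rests on two facts. Since `αM < αQ`, the series of `Γ(r i + c) K ^ i / i!` with `r = αM
/ αQ < 1` converges for every `K` (`summable_Gamma_mul_pow_div_factorial`). And `1 / Γ(s + t)` is at
most a constant times `1 / (Γ(s) Γ(t))` (`inv_Gamma_add_le`), so absolute convergence survives
Cauchy products. -/

theorem antidiagonal_sum_mul_phi (η : ℕ → ℝ) (h0 : η 0 ≠ 0) (h : ℕ) :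
    ∑ p ∈ antidiagonal h, η p.1 * phi η p.2 = η (h + 1) * (h + 1) := by
  rcases h with _ | h
  · simp only [Finset.Nat.antidiagonal_zero, sum_singleton, phi]
    field_simp
    simp
  · rw [Nat.sum_antidiagonal_succ, phi, Nat.sum_antidiagonal_eq_sum_range_succ
      (fun i j => η (i + 1) * phi η j) h, Finset.sum_range]
    push_cast
    field_simp
    ring

/-- The recursion for `phi` says coefficientwise that its generating series is the logarithmic
derivative of that of `η`. -/
theorem derivative_mk (η : ℕ → ℝ) (h0 : η 0 ≠ 0) :
    PowerSeries.derivative ℝ (PowerSeries.mk η) =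
      PowerSeries.mk η * PowerSeries.mk (phi η) := by
  ext n
  simp [PowerSeries.coeff_derivative, PowerSeries.coeff_mul, antidiagonal_sum_mul_phi η h0]

theorem derivative_prod_mk {ι : Type*} (s : Finset ι) (η : ι → ℕ → ℝ)
    (h0 : ∀ l, η l 0 ≠ 0) :
    PowerSeries.derivative ℝ (∏ l ∈ s, PowerSeries.mk (η l)) =
      (∏ l ∈ s, PowerSeries.mk (η l)) * ∑ l ∈ s, PowerSeries.mk (phi (η l)) := by
  classical
  induction s using Finset.induction_on with
  | empty => simp
  | insert a s ha ih =>
    rw [prod_insert ha, sum_insert ha, Derivation.leibniz, ih, derivative_mk _ (h0 a)]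
    simp only [smul_eq_mul]
    ring

/-- Logarithmic derivatives of factors add, so the product `D` satisfies `D' = D * ∑ φ_ℓ`. Its
coefficient of index `i` is the recursion for `δ_{i+1}`. -/
theorem delta_eq_coeff {L : ℕ} (η : Fin L → ℕ → ℝ) (h0 : ∀ l, η l 0 ≠ 0) (i : ℕ) :
    delta η i = PowerSeries.coeff i (∏ l, PowerSeries.mk (η l)) := by
  induction i using Nat.strong_induction_on with
  | _ i ih =>
    rcases i with _ | i
    · rw [delta, PowerSeries.coeff_zero_eq_constantCoeff, map_prod]
      simp
    · have key := congrArg (PowerSeries.coeff i) (derivative_prod_mk univ η h0)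
      rw [PowerSeries.coeff_derivative, mul_comm (∏ l, _),
        PowerSeries.coeff_mul, Nat.sum_antidiagonal_eq_sum_range_succ_mk] at key
      rw [delta, one_div, inv_mul_eq_iff_eq_mul₀ (by positivity), mul_comm, key, sum_range]
      refine sum_congr rfl fun h _ => ?_
      rw [ih _ (by omega), mul_comm]
      simp

end FadingSum

namespace FadingSum

open MeasureTheory Finset Set

/-! ### Integrating series termwise -/

/-- Serves the ratio integral, the convolution and the distribution function. The second conclusion
matters because the summed terms may change sign: nonnegativity of the series is seen only through
the integral of `g`. -/
theorem lintegral_ofReal_eq_tsum_integral {α ι : Type*} [MeasurableSpace α] [Countable ι]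
    {m : Measure α} {F : ι → α → ℝ} {g : α → ℝ}
    (hF : ∀ i, Integrable (F i) m) (hs : Summable fun i => ∫ a, ‖F i a‖ ∂m)
    (hgm : AEStronglyMeasurable g m) (hg : ∀ᵐ a ∂m, g a = ∑' i, F i a) (g0 : ∀ᵐ a ∂m, 0 ≤ g a) :
    ∫⁻ a, ENNReal.ofReal (g a) ∂m = ENNReal.ofReal (∑' i, ∫ a, F i a ∂m) ∧
      0 ≤ ∑' i, ∫ a, F i a ∂m := by
  have hfin : ∑' i, ∫⁻ a, ‖F i a‖ₑ ∂m ≠ ⊤ := by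
    have h (i : ι) : ∫⁻ a, ‖F i a‖ₑ ∂m = ENNReal.ofReal (∫ a, ‖F i a‖ ∂m) := by
      rw [ofReal_integral_eq_lintegral_ofReal (hF i).norm (by filter_upwards with a; positivity)]
      simp only [ofReal_norm]
    simp_rw [h]
    exact hs.tsum_ofReal_ne_top
  have hint : Integrable g m := by
    refine ⟨hgm, lt_of_le_of_lt ?_ hfin.lt_top⟩
    rw [← lintegral_tsum fun i => (hF i).1.enorm]
    refine lintegral_mono_ae (hg.mono fun a ha => ?_)
    rw [ha]
    exact enorm_tsum_le_tsum_enorm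
  have heq : ∫ a, g a ∂m = ∑' i, ∫ a, F i a ∂m := by
    rw [integral_tsum_of_summable_integral_norm hF hs]
    exact integral_congr_ae hg
  rw [← heq]
  exact ⟨(ofReal_integral_eq_lintegral_ofReal hint g0).symm, integral_nonneg_of_ae g0⟩

/-! ### The Euler beta integral -/

theorem integral_Ioo_rpow_mul_rpow {s t x : ℝ} (hs : 0 < s) (ht : 0 < t) (hx : 0 < x) :
    ∫ y in Ioo 0 x, y ^ (s - 1) * (x - y) ^ (t - 1) =
      x ^ (s + t - 1) * (Real.Gamma s * Real.Gamma t / Real.Gamma (s + t)) := by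
  have h1 := Complex.betaIntegral_scaled s t hx
  have h2 := Complex.Gamma_mul_Gamma_eq_betaIntegral (s := s) (t := t) (by simpa) (by simpa)
  rw [← Complex.ofReal_add, Complex.Gamma_ofReal, Complex.Gamma_ofReal, Complex.Gamma_ofReal] at h2
  have h3 : Complex.betaIntegral s t =
      ((Real.Gamma s * Real.Gamma t / Real.Gamma (s + t) : ℝ) : ℂ) := by
    have : ((Real.Gamma (s + t) : ℝ) : ℂ) ≠ 0 :=
      Complex.ofReal_ne_zero.2 (Real.Gamma_pos_of_pos (by positivity)).ne'
    push_cast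
    field_simp
    rw [h2]; ring
  rw [h3, intervalIntegral.integral_of_le hx.le, integral_Ioc_eq_integral_Ioo] at h1
  apply Complex.ofReal_injective
  rw [← integral_complex_ofReal]
  convert h1 using 1
  · refine setIntegral_congr_fun measurableSet_Ioo fun y hy => ?_
    have := sub_pos.2 hy.2
    rw [Complex.ofReal_mul, Complex.ofReal_cpow hy.1.le, Complex.ofReal_cpow this.le]
    push_cast; rfl
  · rw [Complex.ofReal_mul, Complex.ofReal_cpow hx.le]
    push_cast; rfl

theorem integrableOn_Ioo_rpow_mul_rpow {s t x : ℝ} (hs : 0 < s) (ht : 0 < t) (hx : 0 < x) :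
    IntegrableOn (fun y => y ^ (s - 1) * (x - y) ^ (t - 1)) (Ioo 0 x) := by
  -- The Bochner integral of a non-integrable function is `0` by convention, so the nonzero beta
  -- value proves integrability.
  refine Integrable.of_integral_ne_zero ?_
  rw [integral_Ioo_rpow_mul_rpow hs ht hx]
  have := Real.Gamma_pos_of_pos hs
  have := Real.Gamma_pos_of_pos ht
  have := Real.Gamma_pos_of_pos (add_pos hs ht)
  positivity

/-- The beta function decreases in each argument, because powers of a base in `(0, 1)` decrease with
the exponent. The bound dominates the double series of a convolution by a product of two single
series. -/
theorem inv_Gamma_add_le {s t s₀ t₀ : ℝ} (hs₀ : 0 < s₀) (ht₀ : 0 < t₀)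
    (hs : s₀ ≤ s) (ht : t₀ ≤ t) :
    (Real.Gamma (s + t))⁻¹ ≤ Real.Gamma s₀ * Real.Gamma t₀ / Real.Gamma (s₀ + t₀) *
      ((Real.Gamma s)⁻¹ * (Real.Gamma t)⁻¹) := by
  have hs' := hs₀.trans_le hs
  have ht' := ht₀.trans_le ht
  have key : ∫ y in Ioo (0 : ℝ) 1, y ^ (s - 1) * (1 - y) ^ (t - 1) ≤
      ∫ y in Ioo (0 : ℝ) 1, y ^ (s₀ - 1) * (1 - y) ^ (t₀ - 1) := by
    refine setIntegral_mono_on (integrableOn_Ioo_rpow_mul_rpow hs' ht' one_pos)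
      (integrableOn_Ioo_rpow_mul_rpow hs₀ ht₀ one_pos) measurableSet_Ioo fun y hy => ?_
    have h1 := sub_pos.2 hy.2
    have h0 := hy.1
    exact mul_le_mul (Real.rpow_le_rpow_of_exponent_ge h0 hy.2.le (by linarith))
      (Real.rpow_le_rpow_of_exponent_ge h1 (by linarith) (by linarith))
      (by positivity) (by positivity)
  rw [integral_Ioo_rpow_mul_rpow hs' ht' one_pos, integral_Ioo_rpow_mul_rpow hs₀ ht₀ one_pos,
    Real.one_rpow, Real.one_rpow, one_mul, one_mul] at key
  have h1 := Real.Gamma_pos_of_pos hs'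
  have h2 := Real.Gamma_pos_of_pos ht'
  calc (Real.Gamma (s + t))⁻¹ = Real.Gamma s * Real.Gamma t / Real.Gamma (s + t) *
      ((Real.Gamma s)⁻¹ * (Real.Gamma t)⁻¹) := by field_simp
    _ ≤ _ := by gcongr

/-! ### Series in `x ^ (θ i + β - 1) / Γ(θ i + β)` and their convolution -/

/-- The coefficients `a i / Γ(θ i + β)` define an entire power series. -/
def EntireCoeff (θ β : ℝ) (a : ℕ → ℝ) : Prop :=
  ∀ x : ℝ, 0 < x → Summable fun i : ℕ => |a i| * x ^ i / Real.Gamma (θ * i + β)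

/-- The function `∑ i, a i x ^ (θ i + β - 1) / Γ(θ i + β)` on the positive half-line. -/
noncomputable def gammaSeries (θ β : ℝ) (a : ℕ → ℝ) : ℝ → ℝ :=
  (Ioi (0 : ℝ)).indicator fun x => ∑' i : ℕ, a i * x ^ (θ * i + β - 1) / Real.Gamma (θ * i + β)

theorem rpow_mul_natCast_add {x : ℝ} (hx : 0 < x) (θ c : ℝ) (i : ℕ) :
    x ^ (θ * i + c) = (x ^ θ) ^ i * x ^ c := by
  rw [Real.rpow_add hx, Real.rpow_mul hx.le, Real.rpow_natCast]

theorem EntireCoeff.summable_abs {θ β : ℝ} {a : ℕ → ℝ} (h : EntireCoeff θ β a) (c : ℝ) {x : ℝ}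
    (hx : 0 < x) : Summable fun i : ℕ => |a i| * x ^ (θ * i + c) / Real.Gamma (θ * i + β) := by
  refine ((h (x ^ θ) (by positivity)).mul_right (x ^ c)).congr fun i => ?_
  rw [rpow_mul_natCast_add hx]; ring

theorem EntireCoeff.summable {θ β : ℝ} (hθ : 0 < θ) (hβ : 0 < β) {a : ℕ → ℝ}
    (h : EntireCoeff θ β a) (c : ℝ) {x : ℝ}
    (hx : 0 < x) : Summable fun i : ℕ => a i * x ^ (θ * i + c) / Real.Gamma (θ * i + β) := by
  refine Summable.of_norm ?_
  refine (h.summable_abs c hx).congr fun i => ?_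
  have := Real.Gamma_pos_of_pos (s := θ * i + β) (by positivity)
  rw [norm_div, norm_mul, Real.norm_of_nonneg this.le, Real.norm_eq_abs,
    Real.norm_of_nonneg (by positivity)]

theorem measurable_gammaSeries {θ β : ℝ} (hθ : 0 < θ) (hβ : 0 < β) {a : ℕ → ℝ}
    (h : EntireCoeff θ β a) : Measurable (gammaSeries θ β a) := by
  refine measurable_of_tendsto_metrizable (f := fun n => (Ioi (0 : ℝ)).indicator fun x =>
    ∑ i ∈ range n, a i * x ^ (θ * i + β - 1) / Real.Gamma (θ * i + β)) (fun n => ?_) ?_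
  · refine Measurable.indicator ?_ measurableSet_Ioi
    fun_prop
  · rw [tendsto_pi_nhds]
    intro x
    by_cases hx : 0 < x
    · simp only [gammaSeries]
      simp only [indicator_of_mem (Set.mem_Ioi.2 hx), add_sub_assoc]
      exact (h.summable hθ hβ (β - 1) hx).hasSum.tendsto_sum_nat
    · simp [gammaSeries, hx]

/-- The Cauchy product of two sequences. -/
def cauchyProd (a b : ℕ → ℝ) (n : ℕ) : ℝ := ∑ p ∈ antidiagonal n, a p.1 * b p.2

theorem summable_prod_bound {θ β₁ β₂ : ℝ} (hθ : 0 < θ) (hβ₁ : 0 < β₁) (hβ₂ : 0 < β₂)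
    {a b : ℕ → ℝ} (ha : EntireCoeff θ β₁ a) (hb : EntireCoeff θ β₂ b) {x : ℝ} (hx : 0 < x) :
    Summable fun p : ℕ × ℕ => |a p.1| * |b p.2| * x ^ (p.1 + p.2) /
      Real.Gamma (θ * p.1 + β₁ + (θ * p.2 + β₂)) := by
  have h := ((ha x hx).mul_of_nonneg (hb x hx) (fun i => ?_) (fun i => ?_)).mul_left
    (Real.Gamma β₁ * Real.Gamma β₂ / Real.Gamma (β₁ + β₂))
  · refine h.of_nonneg_of_le (fun p => ?_) (fun p => ?_)
    · have := Real.Gamma_pos_of_pos (s := θ * p.1 + β₁ + (θ * p.2 + β₂)) (by positivity)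
      positivity
    · have := inv_Gamma_add_le hβ₁ hβ₂ (s := θ * p.1 + β₁) (t := θ * p.2 + β₂)
        (le_add_of_nonneg_left (by positivity)) (le_add_of_nonneg_left (by positivity))
      calc _ = |a p.1| * |b p.2| * x ^ (p.1 + p.2) *
          (Real.Gamma (θ * p.1 + β₁ + (θ * p.2 + β₂)))⁻¹ := by rw [div_eq_mul_inv]
        _ ≤ |a p.1| * |b p.2| * x ^ (p.1 + p.2) *
          (Real.Gamma β₁ * Real.Gamma β₂ / Real.Gamma (β₁ + β₂) *
          ((Real.Gamma (θ * p.1 + β₁))⁻¹ * (Real.Gamma (θ * p.2 + β₂))⁻¹)) := by gcongr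
        _ = _ := by rw [pow_add]; ring
  all_goals
    have h1 := Real.Gamma_pos_of_pos (s := θ * i + β₁) (by positivity)
    have h2 := Real.Gamma_pos_of_pos (s := θ * i + β₂) (by positivity)
    simp only [Pi.zero_apply]
    positivity

theorem EntireCoeff.cauchyProd {θ β₁ β₂ : ℝ} (hθ : 0 < θ) (hβ₁ : 0 < β₁) (hβ₂ : 0 < β₂)
    {a b : ℕ → ℝ} (ha : EntireCoeff θ β₁ a) (hb : EntireCoeff θ β₂ b) :
    EntireCoeff θ (β₁ + β₂) (cauchyProd a b) := by
  intro x hx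
  have h := summable_prod_bound hθ hβ₁ hβ₂ ha hb hx
  rw [← (Finset.HasAntidiagonal.sigmaAntidiagonalEquivProd (A := ℕ)).summable_iff] at h
  refine h.sigma.of_nonneg_of_le (fun n => ?_) (fun n => ?_)
  · have := Real.Gamma_pos_of_pos (s := θ * n + (β₁ + β₂)) (by positivity)
    positivity
  · have := Real.Gamma_pos_of_pos (s := θ * n + (β₁ + β₂)) (by positivity)
    simp only [Function.comp_apply, HasAntidiagonal.sigmaAntidiagonalEquivProd_apply]
    rw [tsum_fintype, Finset.sum_coe_sort (antidiagonal n) (fun p : ℕ × ℕ =>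
      |a p.1| * |b p.2| * x ^ (p.1 + p.2) / Real.Gamma (θ * p.1 + β₁ + (θ * p.2 + β₂)))]
    calc _ ≤ (∑ p ∈ antidiagonal n, |a p.1 * b p.2|) * x ^ n /
          Real.Gamma (θ * n + (β₁ + β₂)) := by
          gcongr; exact abs_sum_le_sum_abs _ _
      _ = _ := by
          rw [sum_mul, sum_div]
          refine sum_congr rfl fun p hp => ?_
          rw [← mem_antidiagonal.1 hp, abs_mul]
          push_cast
          congr 2
          ring

/-- The product of the two series is integrated termwise by the beta integral, and the double sum is
regrouped along antidiagonals. -/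
theorem lconvolution_gammaSeries {θ β₁ β₂ : ℝ} (hθ : 0 < θ) (hβ₁ : 0 < β₁) (hβ₂ : 0 < β₂)
    {a b : ℕ → ℝ} (ha : EntireCoeff θ β₁ a) (hb : EntireCoeff θ β₂ b)
    (ha0 : ∀ x, 0 ≤ gammaSeries θ β₁ a x) (hb0 : ∀ x, 0 ≤ gammaSeries θ β₂ b x) (x : ℝ) :
    lconvolution (fun y => ENNReal.ofReal (gammaSeries θ β₁ a y))
        (fun y => ENNReal.ofReal (gammaSeries θ β₂ b y)) volume x =
      ENNReal.ofReal (gammaSeries θ (β₁ + β₂) (cauchyProd a b) x) ∧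
    0 ≤ gammaSeries θ (β₁ + β₂) (cauchyProd a b) x := by
  -- Both factors vanish off the positive half-line, so only `0 < y < x` contributes.
  have hrestrict : lconvolution (fun y => ENNReal.ofReal (gammaSeries θ β₁ a y))
        (fun y => ENNReal.ofReal (gammaSeries θ β₂ b y)) volume x =
      ∫⁻ y in Ioo 0 x, ENNReal.ofReal (gammaSeries θ β₁ a y * gammaSeries θ β₂ b (x - y)) := by
    rw [lconvolution_def, ← lintegral_indicator measurableSet_Ioo]
    refine lintegral_congr fun y => ?_
    by_cases hy : y ∈ Ioo 0 x
    · rw [indicator_of_mem hy, ENNReal.ofReal_mul (ha0 _), neg_add_eq_sub]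
    · rw [indicator_of_notMem hy]
      rcases not_and_or.1 hy with h | h
      · simp [gammaSeries, h]
      · have : ¬ y < x := h
        simp only [gammaSeries]
        rw [indicator_of_notMem (a := -y + x) (by simpa using h)]
        simp
  rw [hrestrict]
  by_cases hx : 0 < x
  swap
  · simp [gammaSeries, hx]
  set F : ℕ × ℕ → ℝ → ℝ := fun p y =>
    (a p.1 * y ^ (θ * p.1 + β₁ - 1) / Real.Gamma (θ * p.1 + β₁)) *
      (b p.2 * (x - y) ^ (θ * p.2 + β₂ - 1) / Real.Gamma (θ * p.2 + β₂)) with hF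
  have hFeq (p : ℕ × ℕ) : F p = fun y =>
      (a p.1 * b p.2 / (Real.Gamma (θ * p.1 + β₁) * Real.Gamma (θ * p.2 + β₂))) *
      (y ^ (θ * p.1 + β₁ - 1) * (x - y) ^ (θ * p.2 + β₂ - 1)) := by
    ext y; simp only [hF]; ring
  have hG1 (i : ℕ) : 0 < Real.Gamma (θ * i + β₁) := Real.Gamma_pos_of_pos (by positivity)
  have hG2 (i : ℕ) : 0 < Real.Gamma (θ * i + β₂) := Real.Gamma_pos_of_pos (by positivity)
  have hFint (p : ℕ × ℕ) : IntegrableOn (F p) (Ioo 0 x) := by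
    rw [hFeq]
    exact (integrableOn_Ioo_rpow_mul_rpow (by positivity) (by positivity) hx).const_mul _
  have hFval (p : ℕ × ℕ) : ∫ y in Ioo 0 x, F p y = a p.1 * b p.2 *
      x ^ (θ * p.1 + β₁ + (θ * p.2 + β₂) - 1) /
        Real.Gamma (θ * p.1 + β₁ + (θ * p.2 + β₂)) := by
    have := (hG1 p.1).ne'
    have := (hG2 p.2).ne'
    rw [hFeq, integral_const_mul, integral_Ioo_rpow_mul_rpow (by positivity) (by positivity) hx]
    field_simp
  have hFnorm (p : ℕ × ℕ) : ∫ y in Ioo 0 x, ‖F p y‖ = |a p.1| * |b p.2| *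
      x ^ (θ * p.1 + β₁ + (θ * p.2 + β₂) - 1) /
        Real.Gamma (θ * p.1 + β₁ + (θ * p.2 + β₂)) := by
    have h1 := (hG1 p.1)
    have h2 := (hG2 p.2)
    have : ∀ y ∈ Ioo 0 x, ‖F p y‖ =
        (|a p.1| * |b p.2| / (Real.Gamma (θ * p.1 + β₁) * Real.Gamma (θ * p.2 + β₂))) *
        (y ^ (θ * p.1 + β₁ - 1) * (x - y) ^ (θ * p.2 + β₂ - 1)) := by
      intro y hy
      have h3 := sub_pos.2 hy.2
      have h4 := hy.1
      rw [hFeq, norm_mul, norm_div, norm_mul, Real.norm_eq_abs, Real.norm_eq_abs,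
        Real.norm_of_nonneg (by positivity), Real.norm_of_nonneg (by positivity)]
    rw [setIntegral_congr_fun measurableSet_Ioo this, integral_const_mul,
      integral_Ioo_rpow_mul_rpow (by positivity) (by positivity) hx]
    have := h1.ne'
    have := h2.ne'
    field_simp
  have hpow (p : ℕ × ℕ) : x ^ (θ * p.1 + β₁ + (θ * p.2 + β₂) - 1) =
      (x ^ θ) ^ (p.1 + p.2) * x ^ (β₁ + β₂ - 1) := by
    rw [← rpow_mul_natCast_add hx]
    congr 1; push_cast; ring
  have hxθ : 0 < x ^ θ := by positivity
  have hsum : Summable fun p : ℕ × ℕ => ∫ y in Ioo 0 x, ‖F p y‖ := by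
    simp_rw [hFnorm, hpow]
    refine ((summable_prod_bound hθ hβ₁ hβ₂ ha hb hxθ).mul_right (x ^ (β₁ + β₂ - 1))).congr
      fun p => ?_
    ring
  have hsum' : Summable fun p : ℕ × ℕ => ∫ y in Ioo 0 x, F p y :=
    hsum.of_norm_bounded fun p => norm_integral_le_integral_norm _
  have hprod : ∀ y ∈ Ioo 0 x, gammaSeries θ β₁ a y * gammaSeries θ β₂ b (x - y) =
      ∑' p, F p y := by
    intro y hy
    have h3 := sub_pos.2 hy.2
    simp only [gammaSeries]
    rw [indicator_of_mem (Set.mem_Ioi.2 hy.1), indicator_of_mem (Set.mem_Ioi.2 h3)]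
    simp only [hF, add_sub_assoc]
    refine tsum_mul_tsum_of_summable_norm (ha.summable hθ hβ₁ (β₁ - 1) hy.1).norm
      (hb.summable hθ hβ₂ (β₂ - 1) h3).norm
  have htsum : ∑' p : ℕ × ℕ, ∫ y in Ioo 0 x, F p y =
      gammaSeries θ (β₁ + β₂) (cauchyProd a b) x := by
    rw [← (Finset.HasAntidiagonal.sigmaAntidiagonalEquivProd (A := ℕ)).summable_iff] at hsum'
    rw [← (Finset.HasAntidiagonal.sigmaAntidiagonalEquivProd (A := ℕ)).tsum_eq]
    refine hsum'.tsum_sigma.trans ?_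
    rw [gammaSeries, indicator_of_mem (Set.mem_Ioi.2 hx)]
    refine tsum_congr fun n => ?_
    simp only [Function.comp_apply, HasAntidiagonal.sigmaAntidiagonalEquivProd_apply, hFval]
    rw [tsum_fintype, Finset.sum_coe_sort (antidiagonal n) (fun p : ℕ × ℕ =>
      a p.1 * b p.2 * x ^ (θ * p.1 + β₁ + (θ * p.2 + β₂) - 1) /
        Real.Gamma (θ * p.1 + β₁ + (θ * p.2 + β₂))), cauchyProd, sum_mul, sum_div]
    refine sum_congr rfl fun p hp => ?_
    rw [← mem_antidiagonal.1 hp, Nat.cast_add,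
      show θ * p.1 + β₁ + (θ * p.2 + β₂) = θ * (p.1 + p.2) + (β₁ + β₂) by ring]
  rw [← htsum]
  exact lintegral_ofReal_eq_tsum_integral hFint hsum
    ((measurable_gammaSeries hθ hβ₁ ha).mul ((measurable_gammaSeries hθ hβ₂ hb).comp
      (measurable_const.sub measurable_id))).aestronglyMeasurable
    (ae_restrict_of_forall_mem measurableSet_Ioo hprod)
    (.of_forall fun y => mul_nonneg (ha0 _) (hb0 _))

theorem IsPDF.conv_gammaSeries {θ β₁ β₂ : ℝ} (hθ : 0 < θ) (hβ₁ : 0 < β₁) (hβ₂ : 0 < β₂)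
    {a b : ℕ → ℝ} (ha : EntireCoeff θ β₁ a) (hb : EntireCoeff θ β₂ b) {m₁ m₂ : Measure ℝ}
    (h₁ : IsPDF m₁ (gammaSeries θ β₁ a)) (h₂ : IsPDF m₂ (gammaSeries θ β₂ b)) :
    IsPDF (m₁.conv m₂) (gammaSeries θ (β₁ + β₂) (cauchyProd a b)) := by
  have key := lconvolution_gammaSeries hθ hβ₁ hβ₂ ha hb h₁.2.1 h₂.2.1
  refine ⟨measurable_gammaSeries hθ (by positivity) (ha.cauchyProd hθ hβ₁ hβ₂ hb),
    fun x => (key x).2, ?_⟩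
  rw [h₁.2.2, h₂.2.2, conv_withDensity_eq_lconvolution h₁.1.ennreal_ofReal h₂.1.ennreal_ofReal]
  congr 1
  ext x
  exact (key x).1

end FadingSum

namespace FadingSum

open MeasureTheory ProbabilityTheory Set Filter Topology

/-! ### Growth of the coefficients -/

theorem exists_mul_rpow_le {r K : ℝ} (hr : 0 < r) (hr1 : r < 1) (hK : 0 < K) :
    ∃ C, ∀ t : ℝ, 0 < t → K * t ^ r ≤ t / 2 + C := by
  -- `T` is the positive solution of `K * t ^ r = t / 2`; beyond it the linear term wins, below it
  -- `K * T ^ r` bounds the left side.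
  set T := (2 * K) ^ (1 / (1 - r)) with hT
  have h1r : 0 < 1 - r := by linarith
  have hTpos : 0 < T := by positivity
  refine ⟨K * T ^ r, fun t ht => ?_⟩
  rcases le_total t T with h | h
  · have : t ^ r ≤ T ^ r := Real.rpow_le_rpow ht.le h hr.le
    nlinarith [mul_le_mul_of_nonneg_left this hK.le]
  · have h2 : 2 * K ≤ t ^ (1 - r) := by
      calc 2 * K = T ^ (1 - r) := by
            rw [hT, ← Real.rpow_mul (by positivity), one_div, inv_mul_cancel₀ h1r.ne',
              Real.rpow_one]
        _ ≤ _ := Real.rpow_le_rpow hTpos.le h h1r.le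
    have h3 : t ^ (1 - r) * t ^ r = t := by
      rw [← Real.rpow_add ht]; simp
    have h4 : 0 < t ^ r := by positivity
    have h5 : 0 < K * T ^ r := by positivity
    nlinarith [mul_le_mul_of_nonneg_right h2 h4.le]

/-- With `Γ` written as an integral, every finite partial sum is at most `∫ exp(-t) t ^ (c - 1)
exp(K t ^ r)`. As `r < 1`, the last exponent is at most `t / 2 + C`, so the integral is finite. -/
theorem summable_Gamma_mul_pow_div_factorial {r c K : ℝ} (hr : 0 < r) (hr1 : r < 1) (hc : 0 < c)
    (hK : 0 < K) : Summable fun i : ℕ => Real.Gamma (r * i + c) * K ^ i / (i.factorial : ℝ) := by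
  obtain ⟨C, hC⟩ := exists_mul_rpow_le hr hr1 hK
  have hint (i : ℕ) : IntegrableOn (fun t : ℝ => Real.exp (-t) * t ^ (r * i + c - 1) *
      (K ^ i / (i.factorial : ℝ))) (Ioi 0) :=
    (Real.GammaIntegral_convergent (s := r * i + c) (by positivity)).mul_const _
  have hval (i : ℕ) : Real.Gamma (r * i + c) * K ^ i / (i.factorial : ℝ) =
      ∫ t in Ioi (0 : ℝ), Real.exp (-t) * t ^ (r * i + c - 1) * (K ^ i / (i.factorial : ℝ)) := by
    rw [integral_mul_const, ← Real.Gamma_eq_integral (by positivity), mul_div_assoc]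
  have hbound : IntegrableOn (fun t : ℝ => Real.exp C * (t ^ (c - 1) * Real.exp (-(1 / 2) * t ^ (1 : ℝ))))
      (Ioi 0) :=
    (integrableOn_rpow_mul_exp_neg_mul_rpow (by linarith) one_pos (by norm_num)).const_mul _
  refine summable_of_sum_le (c := ∫ t in Ioi (0 : ℝ), Real.exp C * (t ^ (c - 1) *
    Real.exp (-(1 / 2) * t ^ (1 : ℝ)))) (fun i => ?_) (fun s => ?_)
  · have := Real.Gamma_pos_of_pos (s := r * i + c) (by positivity)
    positivity
  · simp_rw [hval]
    rw [← integral_finsetSum _ fun i _ => hint i]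
    refine setIntegral_mono_on (integrable_finsetSum _ fun i _ => hint i) hbound
      measurableSet_Ioi fun t ht => ?_
    have ht : 0 < t := ht
    have hpow (i : ℕ) : Real.exp (-t) * t ^ (r * i + c - 1) * (K ^ i / (i.factorial : ℝ)) =
        Real.exp (-t) * t ^ (c - 1) * ((K * t ^ r) ^ i / (i.factorial : ℝ)) := by
      rw [add_sub_assoc, rpow_mul_natCast_add ht, mul_pow]; ring
    simp_rw [hpow]
    rw [← Finset.mul_sum]
    have hexp : ∑ i ∈ s, (K * t ^ r) ^ i / (i.factorial : ℝ) ≤ Real.exp (K * t ^ r) := by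
      rw [Real.exp_eq_exp_ℝ, NormedSpace.exp_eq_tsum_div]
      exact (Real.summable_pow_div_factorial _).sum_le_tsum s (fun i _ => by positivity)
    calc _ ≤ Real.exp (-t) * t ^ (c - 1) * Real.exp (K * t ^ r) := by gcongr
      _ ≤ Real.exp (-t) * t ^ (c - 1) * Real.exp (t / 2 + C) := by gcongr; exact hC t ht
      _ = Real.exp C * (t ^ (c - 1) * (Real.exp (-t) * Real.exp (t / 2))) := by
          rw [Real.exp_add]; ring
      _ = _ := by
          rw [← Real.exp_add, Real.rpow_one]; ring_nf

theorem Gamma_add_natCast_le {x : ℝ} (hx : 0 < x) (n : ℕ) :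
    Real.Gamma (x + n) ≤ (x + n) ^ n * Real.Gamma x := by
  induction n with
  | zero => simp
  | succ n ih =>
    have h := Real.Gamma_pos_of_pos hx
    rw [Nat.cast_succ, ← add_assoc, Real.Gamma_add_one (by positivity)]
    calc (x + n) * Real.Gamma (x + n) ≤ (x + n) * ((x + n) ^ n * Real.Gamma x) := by gcongr
      _ = (x + n) ^ (n + 1) * Real.Gamma x := by ring
      _ ≤ _ := mul_le_mul_of_nonneg_right
          (pow_le_pow_left₀ (by positivity) (by linarith) _) h.le

theorem exists_Gamma_add_le_mul_exp (c d : ℝ) (hd : 0 < d) :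
    ∃ C, ∀ᶠ x : ℝ in atTop, Real.Gamma (x + c) ≤ C * Real.exp x * Real.Gamma (x + d) := by
  obtain ⟨n, hn⟩ := exists_nat_ge (c - d)
  refine ⟨n.factorial * Real.exp (d + n), ?_⟩
  -- The first condition puts `x + c` in `[2, ∞)`, where `Γ` is increasing.
  filter_upwards [eventually_ge_atTop (2 - c), eventually_ge_atTop 0] with x hx hx0
  have hG := Real.Gamma_pos_of_pos (s := x + d) (by positivity)
  calc Real.Gamma (x + c) ≤ Real.Gamma (x + d + n) :=
        Real.Gamma_strictMonoOn_Ici.monotoneOn (mem_Ici.2 (by linarith))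
          (mem_Ici.2 (by linarith)) (by linarith)
    _ ≤ (x + d + n) ^ n * Real.Gamma (x + d) := Gamma_add_natCast_le (by positivity) n
    _ ≤ (n.factorial * Real.exp (x + d + n)) * Real.Gamma (x + d) := by
        gcongr
        have := Real.pow_div_factorial_le_exp (x + d + n) (by positivity) n
        rwa [div_le_iff₀ (by positivity), mul_comm] at this
    _ = _ := by rw [show x + d + n = x + (d + n) by ring, Real.exp_add]; ring

section Coefficients

variable {αM αQ μM μQ ϱ : ℝ}

/-- Separates the Gamma factor cancelled by the normalisation in `EntireCoeff` from a term of the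
summable series above. -/
theorem abs_u (hαM : 0 < αM) (hαQ : 0 < αQ) (hμM : 0 < μM) (hμQ : 0 < μQ) (hϱ : 0 < ϱ) (i : ℕ) :
    |u αM αQ μM μQ ϱ i| = ϱ ^ (αM * μM) * Real.Gamma (αM * i + αM * μM) *
      (Real.Gamma (αM / αQ * i + (αM * μM / αQ + μQ)) * (ϱ ^ αM) ^ i / (i.factorial : ℝ)) := by
  have h1 : αM * (i + μM) = αM * i + αM * μM := by ring
  have h2 : αM * (i + μM) / αQ + μQ = αM / αQ * i + (αM * μM / αQ + μQ) := by ring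
  have h3 : αM * (μM + i) = αM * i + αM * μM := by ring
  have hG1 := Real.Gamma_pos_of_pos (s := αM * i + αM * μM) (by positivity)
  have hG2 := Real.Gamma_pos_of_pos (s := αM / αQ * i + (αM * μM / αQ + μQ)) (by positivity)
  rw [u, h2, h1, h3, rpow_mul_natCast_add hϱ]
  simp only [abs_div, abs_mul, abs_pow, abs_neg, abs_one, one_pow, one_mul, Nat.abs_cast]
  rw [abs_of_pos hG1, abs_of_pos hG2, abs_of_pos (show 0 < ϱ ^ αM by positivity),
    abs_of_pos (show 0 < ϱ ^ (αM * μM) by positivity)]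
  ring

theorem entireCoeff_u (hαM : 0 < αM) (hαMQ : αM < αQ) (hμM : 0 < μM) (hμQ : 0 < μQ)
    (hϱ : 0 < ϱ) : EntireCoeff αM (αM * μM) (u αM αQ μM μQ ϱ) := by
  intro x hx
  have hαQ := hαM.trans hαMQ
  refine ((summable_Gamma_mul_pow_div_factorial (r := αM / αQ) (c := αM * μM / αQ + μQ)
    (K := ϱ ^ αM * x) (by positivity) ((div_lt_one hαQ).2 hαMQ) (by positivity)
    (by positivity)).mul_left (ϱ ^ (αM * μM))).congr fun i => ?_
  have hG1 := Real.Gamma_pos_of_pos (s := αM * i + αM * μM) (by positivity)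
  rw [abs_u hαM hαQ hμM hμQ hϱ, mul_pow]
  field_simp

theorem tendsto_abs_u_div_Gamma (hαM : 0 < αM) (hαMQ : αM < αQ) (hμM : 0 < μM) (hμQ : 0 < μQ)
    (hϱ : 0 < ϱ) {ε : ℝ} (hε : 0 < ε) :
    Tendsto (fun i : ℕ => |u αM αQ μM μQ ϱ i| / Real.Gamma (i * αM + ε)) atTop (𝓝 0) := by
  have hαQ := hαM.trans hαMQ
  obtain ⟨C, hC⟩ := exists_Gamma_add_le_mul_exp (αM * μM) ε hε
  have hlim : Tendsto (fun i : ℕ => αM * (i : ℝ)) atTop atTop :=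
    tendsto_natCast_atTop_atTop.const_mul_atTop hαM
  -- Replacing the shift `αM * μM` by `ε` inside `Γ` costs a factor `exp(αM * i)`, absorbed into
  -- `K`.
  have hsum := ((summable_Gamma_mul_pow_div_factorial (r := αM / αQ) (c := αM * μM / αQ + μQ)
    (K := ϱ ^ αM * Real.exp αM) (by positivity) ((div_lt_one hαQ).2 hαMQ) (by positivity)
    (by positivity)).mul_left (C * ϱ ^ (αM * μM))).tendsto_atTop_zero
  refine squeeze_zero' (.of_forall fun i => ?_) ?_ hsum
  · have := Real.Gamma_pos_of_pos (s := i * αM + ε) (by positivity)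
    positivity
  · filter_upwards [hlim.eventually hC] with i hi
    have hG := Real.Gamma_pos_of_pos (s := αM * i + ε) (by positivity)
    have hG2 := Real.Gamma_pos_of_pos (s := αM / αQ * i + (αM * μM / αQ + μQ)) (by positivity)
    rw [mul_comm (i : ℝ), div_le_iff₀ hG, abs_u hαM hαQ hμM hμQ hϱ]
    calc _ ≤ ϱ ^ (αM * μM) * (C * Real.exp (αM * i) * Real.Gamma (αM * i + ε)) *
        (Real.Gamma (αM / αQ * i + (αM * μM / αQ + μQ)) * (ϱ ^ αM) ^ i / (i.factorial : ℝ)) := by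
          gcongr
      _ = _ := by rw [mul_comm αM (i : ℝ), Real.exp_nat_mul, mul_pow]; ring

theorem u_zero_pos (hαM : 0 < αM) (hαQ : 0 < αQ) (hμM : 0 < μM) (hμQ : 0 < μQ) (hϱ : 0 < ϱ) :
    0 < u αM αQ μM μQ ϱ 0 := by
  have hG1 := Real.Gamma_pos_of_pos (s := αM * (0 + μM)) (by positivity)
  have hG2 := Real.Gamma_pos_of_pos (s := αM * (0 + μM) / αQ + μQ) (by positivity)
  simp only [u, Nat.cast_zero]
  positivity

theorem ratioTerm_eq (hαM : 0 < αM) (hμM : 0 < μM) (hϱ : 0 < ϱ) {z : ℝ} (hz : 0 < z) (i : ℕ) :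
    ratioTerm αM αQ μM μQ ϱ z i =
      z * (u αM αQ μM μQ ϱ i * z ^ (αM * i + αM * μM - 1) / Real.Gamma (αM * i + αM * μM)) := by
  have h1 : αM * (i + μM) = αM * i + αM * μM := by ring
  have h3 : αM * (μM + i) = αM * i + αM * μM := by ring
  have hG1 := (Real.Gamma_pos_of_pos (s := αM * i + αM * μM) (by positivity)).ne'
  rw [ratioTerm, u, h1, h3, Real.mul_rpow hϱ.le hz.le, Real.rpow_sub_one hz.ne']
  field_simp

theorem summable_ratioTerm (hαM : 0 < αM) (hαMQ : αM < αQ) (hμM : 0 < μM) (hμQ : 0 < μQ)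
    (hϱ : 0 < ϱ) {z : ℝ} (hz : 0 < z) : Summable (ratioTerm αM αQ μM μQ ϱ z) := by
  refine (((entireCoeff_u hαM hαMQ hμM hμQ hϱ).summable hαM (by positivity)
    (αM * μM - 1) hz).mul_left z).congr fun i => ?_
  rw [ratioTerm_eq hαM hμM hϱ hz, add_sub_assoc]

end Coefficients

end FadingSum

namespace FadingSum

open MeasureTheory ProbabilityTheory Set Filter Topology
open scoped ENNReal

/-! ### The law of a ratio -/

theorem lintegral_eq_lintegral_mul_left {y : ℝ} (hy : 0 < y) (h : ℝ → ℝ≥0∞) (hh : Measurable h) :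
    ∫⁻ x, h x = ENNReal.ofReal y * ∫⁻ z, h (y * z) := by
  conv_lhs => rw [← Real.smul_map_volume_mul_left hy.ne']
  rw [lintegral_smul_measure, lintegral_map hh (measurable_const_mul y), abs_of_pos hy,
    smul_eq_mul]

/-- Substitute `x = y * z` for fixed `y > 0`, with Jacobian `y`, and apply Tonelli. Since `g`
vanishes for `y ≤ 0`, division by zero plays no role. -/
theorem map_div_eq_withDensity {S : Type*} [MeasurableSpace S] {P : Measure S}
    [IsFiniteMeasure P] {X Y : S → ℝ} {f g : ℝ → ℝ≥0∞} (hf : Measurable f) (hg : Measurable g)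
    (hg0 : ∀ y ≤ 0, g y = 0)
    (hX : HasLaw X (volume.withDensity f) P) (hY : HasLaw Y (volume.withDensity g) P)
    (hXY : IndepFun X Y P) :
    P.map (fun ω => X ω / Y ω) =
      volume.withDensity fun z => ∫⁻ y in Ioi 0, ENNReal.ofReal y * g y * f (y * z) := by
  have hXY' := (indepFun_iff_map_prod_eq_prod_map_map hX.aemeasurable hY.aemeasurable).1 hXY
  have hfinX : IsFiniteMeasure (volume.withDensity f) := hX.map_eq ▸ inferInstance
  have hfinY : IsFiniteMeasure (volume.withDensity g) := hY.map_eq ▸ inferInstance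
  refine Measure.ext_of_lintegral _ fun φ hφ => ?_
  have hmap : P.map (fun ω => X ω / Y ω) =
      ((volume.withDensity f).prod (volume.withDensity g)).map fun p => p.1 / p.2 := by
    rw [← hX.map_eq, ← hY.map_eq, ← hXY', AEMeasurable.map_map_of_aemeasurable
      (by fun_prop) (hX.aemeasurable.prodMk hY.aemeasurable)]
    rfl
  have hdiv : Measurable fun p : ℝ × ℝ => φ (p.1 / p.2) := by fun_prop
  rw [hmap, lintegral_map hφ (by fun_prop), lintegral_prod_symm _ hdiv.aemeasurable,
    lintegral_withDensity_eq_lintegral_mul _ hg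
      (Measurable.lintegral_prod_left' hdiv)]
  have hstep (y : ℝ) : (g * fun y => ∫⁻ x, φ (x / y) ∂volume.withDensity f) y =
      (Ioi 0).indicator
        (fun y => ∫⁻ z, ENNReal.ofReal y * g y * f (y * z) * φ z) y := by
    by_cases hy : 0 < y
    · have hφy : Measurable fun x => φ (x / y) := by fun_prop
      rw [indicator_of_mem (Set.mem_Ioi.2 hy), Pi.mul_apply,
        lintegral_withDensity_eq_lintegral_mul _ hf hφy,
        lintegral_eq_lintegral_mul_left hy _ (hf.mul hφy), ← mul_assoc, mul_comm (g y),
        ← lintegral_const_mul _ (by fun_prop)]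
      refine lintegral_congr fun z => ?_
      rw [Pi.mul_apply, mul_div_cancel_left₀ _ hy.ne', mul_assoc, mul_assoc, mul_assoc]
    · rw [indicator_of_notMem (by simpa using hy), Pi.mul_apply, hg0 y (not_lt.1 hy), zero_mul]
  rw [lintegral_congr hstep, lintegral_indicator measurableSet_Ioi,
    lintegral_withDensity_eq_lintegral_mul _ (by fun_prop) hφ, lintegral_lintegral_swap
      (by fun_prop)]
  refine lintegral_congr fun z => ?_
  rw [Pi.mul_apply, lintegral_mul_const _ (by fun_prop)]

theorem alphaMuPDF_of_pos {α μ Ω x : ℝ} (hμ : 0 < μ) (hΩ : 0 < Ω) (hx : 0 < x) :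
    alphaMuPDF α μ Ω x = α * (μ / Ω ^ α) ^ μ / Real.Gamma μ * x ^ (α * μ - 1) *
      Real.exp (-(μ / Ω ^ α) * x ^ α) := by
  rw [alphaMuPDF, indicator_of_mem (Set.mem_Ioi.2 hx), Real.div_rpow hμ.le (by positivity),
    ← Real.rpow_mul hΩ.le]
  congr 1
  · field_simp
  · congr 1; ring

theorem alphaMuPDF_of_nonpos {α μ Ω x : ℝ} (hx : x ≤ 0) : alphaMuPDF α μ Ω x = 0 := by
  rw [alphaMuPDF, indicator_of_notMem (by simpa using hx)]

theorem measurable_alphaMuPDF (α μ Ω : ℝ) : Measurable (alphaMuPDF α μ Ω) := by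
  unfold alphaMuPDF
  exact Measurable.indicator (by fun_prop) measurableSet_Ioi

theorem alphaMuPDF_nonneg {α μ Ω : ℝ} (hα : 0 < α) (hμ : 0 < μ) (hΩ : 0 < Ω) (x : ℝ) :
    0 ≤ alphaMuPDF α μ Ω x := by
  rcases le_or_gt x 0 with hx | hx
  · rw [alphaMuPDF_of_nonpos hx]
  · rw [alphaMuPDF_of_pos hμ hΩ hx]
    have := Real.Gamma_pos_of_pos hμ
    positivity

theorem rhoTilde_pos {αM αQ μM μQ ΩM ΩQ : ℝ} (hμM : 0 < μM) (hμQ : 0 < μQ) (hΩM : 0 < ΩM)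
    (hΩQ : 0 < ΩQ) : 0 < rhoTilde αM αQ μM μQ ΩM ΩQ := by
  unfold rhoTilde; positivity

/-- Expresses the powers of `ϱ̃` through the rates `μ / Ω ^ α` in the exponents of the two
densities, which are what the Gamma integrals produce. -/
theorem rhoTilde_rpow {αM αQ μM μQ ΩM ΩQ : ℝ} (hαM : 0 < αM) (hαQ : 0 < αQ) (hμM : 0 < μM)
    (hμQ : 0 < μQ) (hΩM : 0 < ΩM) (hΩQ : 0 < ΩQ) (s : ℝ) :
    rhoTilde αM αQ μM μQ ΩM ΩQ ^ (αM * s) =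
      (μM / ΩM ^ αM) ^ s * (μQ / ΩQ ^ αQ) ^ (-(αM * s / αQ)) := by
  rw [rhoTilde, Real.rpow_neg (by positivity), Real.div_rpow (by positivity) (by positivity),
    Real.mul_rpow (by positivity) (by positivity), Real.mul_rpow (by positivity) (by positivity),
    Real.div_rpow (by positivity) (by positivity), Real.div_rpow (by positivity) (by positivity),
    ← Real.rpow_mul (by positivity), ← Real.rpow_mul (by positivity),
    ← Real.rpow_mul (by positivity), ← Real.rpow_mul (by positivity),
    show 1 / αM * (αM * s) = s by field_simp, show 1 / αQ * (αM * s) = αM * s / αQ by ring,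
    show αQ * (αM * s / αQ) = αM * s by field_simp]
  field_simp

/-- The exponential series of the numerator density, integrated against the denominator density. -/
theorem lintegral_alphaMuPDF_mul {αM αQ μM μQ ΩM ΩQ z : ℝ} (hαM : 0 < αM) (hαMQ : αM < αQ)
    (hμM : 0 < μM) (hμQ : 0 < μQ) (hΩM : 0 < ΩM) (hΩQ : 0 < ΩQ) (hz : 0 < z) {ϱ : ℝ}
    (hϱ : ϱ = rhoTilde αM αQ μM μQ ΩM ΩQ) :
    ∫⁻ y in Ioi 0, ENNReal.ofReal (y * alphaMuPDF αQ μQ ΩQ y * alphaMuPDF αM μM ΩM (y * z)) =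
      ENNReal.ofReal (∑' i, αM / (z * Real.Gamma μM * Real.Gamma μQ) *
        ratioTerm αM αQ μM μQ ϱ z i) ∧
    0 ≤ ∑' i, αM / (z * Real.Gamma μM * Real.Gamma μQ) * ratioTerm αM αQ μM μQ ϱ z i := by
  have hαQ := hαM.trans hαMQ
  have hΓM := Real.Gamma_pos_of_pos hμM
  have hΓQ := Real.Gamma_pos_of_pos hμQ
  have hϱ0 : 0 < ϱ := hϱ ▸ rhoTilde_pos hμM hμQ hΩM hΩQ
  set A := μM / ΩM ^ αM with hA
  set B := μQ / ΩQ ^ αQ with hB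
  have hA0 : 0 < A := by positivity
  have hB0 : 0 < B := by positivity
  set D := αM * A ^ μM / Real.Gamma μM * (αQ * B ^ μQ / Real.Gamma μQ) * z ^ (αM * μM - 1) with hD
  have hD0 : 0 < D := by positivity
  -- `q i` collects the powers of `y`: the Jacobian `1`, the prefactors `αQ * μQ - 1` and `αM * μM -
  -- 1`, and `αM * i` from the expanded exponential.
  set q : ℕ → ℝ := fun i => αM * (i + μM) + αQ * μQ - 1 with hq
  have hq1 (i : ℕ) : -1 < q i := by
    have : 0 < αM * (i + μM) + αQ * μQ := by positivity
    simp only [hq]; linarith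
  have hqdiv (i : ℕ) : (q i + 1) / αQ = αM * (i + μM) / αQ + μQ := by
    simp only [hq]; field_simp; ring
  set k : ℕ → ℝ := fun i => D * ((-1) ^ i / (i.factorial : ℝ) * (A * z ^ αM) ^ i) with hk
  set F : ℕ → ℝ → ℝ := fun i y => k i * (y ^ q i * Real.exp (-B * y ^ αQ)) with hF
  have hint (i : ℕ) : IntegrableOn (F i) (Ioi 0) :=
    (integrableOn_rpow_mul_exp_neg_mul_rpow (hq1 i) hαQ hB0).const_mul _
  have hval (i : ℕ) : ∫ y in Ioi 0, F i y =
      αM / (z * Real.Gamma μM * Real.Gamma μQ) * ratioTerm αM αQ μM μQ ϱ z i := by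
    simp only [hF]
    rw [integral_const_mul, integral_rpow_mul_exp_neg_mul_rpow hαQ (hq1 i) hB0, hqdiv, ratioTerm,
      Real.mul_rpow hϱ0.le hz.le, hϱ, rhoTilde_rpow hαM hαQ hμM hμQ hΩM hΩQ, ← hA, ← hB]
    have e1 : -(q i + 1) / αQ = -(αM * (i + μM) / αQ) + -μQ := by
      rw [neg_div, hqdiv]; ring
    have e2 : αM * ((i : ℝ) + μM) = αM * i + αM * μM := by ring
    have e3 : A ^ ((i : ℝ) + μM) = A ^ i * A ^ μM := by
      rw [Real.rpow_add hA0, Real.rpow_natCast]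
    have e4 : z ^ (αM * (i + μM)) = (z ^ αM) ^ i * z ^ (αM * μM) := by
      rw [e2, rpow_mul_natCast_add hz]
    have e5 : B ^ (-μQ) = (B ^ μQ)⁻¹ := Real.rpow_neg hB0.le _
    rw [e1, Real.rpow_add hB0, e3, e4, e5]
    simp only [hk, hD]
    rw [Real.rpow_sub_one hz.ne', mul_pow]
    have : B ^ μQ ≠ 0 := by positivity
    field_simp
  -- Each `F i` has constant sign on the half-line, so its `L¹` norm is the absolute value of its
  -- integral.
  have hnorm (i : ℕ) : ∫ y in Ioi 0, ‖F i y‖ =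
      ‖αM / (z * Real.Gamma μM * Real.Gamma μQ) * ratioTerm αM αQ μM μQ ϱ z i‖ := by
    rw [← hval]
    have h1 : ∀ y ∈ Ioi (0 : ℝ), ‖F i y‖ = ‖k i‖ * (y ^ q i * Real.exp (-B * y ^ αQ)) := by
      intro y hy
      have hy : 0 < y := hy
      simp only [hF]
      rw [norm_mul, Real.norm_of_nonneg (show 0 ≤ y ^ q i * Real.exp (-B * y ^ αQ) by positivity)]
    rw [setIntegral_congr_fun measurableSet_Ioi h1, integral_const_mul]
    simp only [hF]
    rw [integral_const_mul, norm_mul (k i), Real.norm_of_nonneg (setIntegral_nonneg measurableSet_Ioi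
      fun y hy => ?_)]
    have hy : 0 < y := hy
    positivity
  have hsum : Summable fun i => ∫ y in Ioi 0, ‖F i y‖ := by
    simp_rw [hnorm]
    exact ((summable_ratioTerm hαM hαMQ hμM hμQ hϱ0 hz).mul_left _).norm
  have hseries : ∀ y ∈ Ioi (0 : ℝ),
      y * alphaMuPDF αQ μQ ΩQ y * alphaMuPDF αM μM ΩM (y * z) = ∑' i, F i y := by
    intro y hy
    have hy : 0 < y := hy
    rw [alphaMuPDF_of_pos hμQ hΩQ hy, alphaMuPDF_of_pos hμM hΩM (by positivity), ← hA, ← hB]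
    have hFy (i : ℕ) : F i y = D * y ^ (αM * μM + αQ * μQ - 1) * Real.exp (-B * y ^ αQ) *
        ((-A * (y * z) ^ αM) ^ i / (i.factorial : ℝ)) := by
      have e : q i = αM * i + (αM * μM + αQ * μQ - 1) := by simp only [hq]; ring
      simp only [hF, hk]
      rw [e, rpow_mul_natCast_add hy, Real.mul_rpow hy.le hz.le, neg_mul, neg_pow,
        mul_pow, mul_pow, mul_pow]
      ring
    simp_rw [hFy]
    rw [tsum_mul_left, ← congrFun NormedSpace.exp_eq_tsum_div, ← Real.exp_eq_exp_ℝ]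
    have e1 : y ^ (αM * μM + αQ * μQ - 1) = y * (y ^ (αQ * μQ - 1) * y ^ (αM * μM - 1)) := by
      rw [show αM * μM + αQ * μQ - 1 = 1 + ((αQ * μQ - 1) + (αM * μM - 1)) by ring,
        Real.rpow_add hy, Real.rpow_add hy, Real.rpow_one]
    rw [e1, Real.mul_rpow hy.le hz.le]
    simp only [hD]
    ring
  have key := lintegral_ofReal_eq_tsum_integral (m := volume.restrict (Ioi (0 : ℝ)))
    (g := fun y => y * alphaMuPDF αQ μQ ΩQ y * alphaMuPDF αM μM ΩM (y * z)) hint hsum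
    (((measurable_id.mul (measurable_alphaMuPDF _ _ _)).mul ((measurable_alphaMuPDF _ _ _).comp
      (measurable_id.mul_const z))).aestronglyMeasurable)
    (ae_restrict_of_forall_mem measurableSet_Ioi hseries)
    (ae_restrict_of_forall_mem measurableSet_Ioi fun y hy => mul_nonneg (mul_nonneg
      (le_of_lt hy) (alphaMuPDF_nonneg hαQ hμQ hΩQ _)) (alphaMuPDF_nonneg hαM hμM hΩM _))
  simpa only [hval] using key

theorem indicator_ratio_eq_gammaSeries {αM αQ μM μQ ϱ : ℝ} (hαM : 0 < αM) (hμM : 0 < μM)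
    (hϱ : 0 < ϱ) :
    ((Ioi (0 : ℝ)).indicator fun z => αM / (z * Real.Gamma μM * Real.Gamma μQ)
        * ∑' i, ratioTerm αM αQ μM μQ ϱ z i) =
      gammaSeries αM (αM * μM) fun i =>
        αM / (Real.Gamma μM * Real.Gamma μQ) * u αM αQ μM μQ ϱ i := by
  refine indicator_congr fun z hz => ?_
  have hz : 0 < z := hz
  rw [← tsum_mul_left]
  refine tsum_congr fun i => ?_
  rw [ratioTerm_eq hαM hμM hϱ hz]
  field_simp

theorem EntireCoeff.const_mul {θ β : ℝ} {a : ℕ → ℝ} (h : EntireCoeff θ β a) (c : ℝ) :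
    EntireCoeff θ β fun i => c * a i := by
  intro x hx
  refine ((h x hx).mul_left |c|).congr fun i => ?_
  rw [abs_mul]; ring

theorem isPDF_ratio {S : Type*} [MeasurableSpace S] {P : Measure S} [IsFiniteMeasure P]
    {αM αQ μM μQ ΩM ΩQ : ℝ} (hαM : 0 < αM) (hαMQ : αM < αQ)
    (hμM : 0 < μM) (hμQ : 0 < μQ) (hΩM : 0 < ΩM) (hΩQ : 0 < ΩQ) {M Q : S → ℝ}
    (hM : HasLaw M (alphaMuLaw αM μM ΩM) P) (hQ : HasLaw Q (alphaMuLaw αQ μQ ΩQ) P)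
    (hMQ : IndepFun M Q P) :
    IsPDF (P.map fun ω => M ω / Q ω) ((Ioi (0 : ℝ)).indicator fun z =>
      αM / (z * Real.Gamma μM * Real.Gamma μQ) *
        ∑' i, ratioTerm αM αQ μM μQ (rhoTilde αM αQ μM μQ ΩM ΩQ) z i) := by
  have hϱ := rhoTilde_pos (αM := αM) (αQ := αQ) hμM hμQ hΩM hΩQ
  have hαQ := hαM.trans hαMQ
  refine ⟨?_, fun z => ?_, ?_⟩
  · rw [indicator_ratio_eq_gammaSeries hαM hμM hϱ]
    exact measurable_gammaSeries hαM (by positivity)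
      ((entireCoeff_u hαM hαMQ hμM hμQ hϱ).const_mul _)
  · refine indicator_nonneg (fun z hz => ?_) z
    rw [← tsum_mul_left]
    exact (lintegral_alphaMuPDF_mul hαM hαMQ hμM hμQ hΩM hΩQ hz rfl).2
  · rw [map_div_eq_withDensity (measurable_alphaMuPDF αM μM ΩM).ennreal_ofReal
      (measurable_alphaMuPDF αQ μQ ΩQ).ennreal_ofReal
      (fun y hy => by rw [alphaMuPDF_of_nonpos hy, ENNReal.ofReal_zero]) hM hQ hMQ]
    congr 1
    ext z
    by_cases hz : 0 < z
    · rw [indicator_of_mem (Set.mem_Ioi.2 hz), ← tsum_mul_left,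
        ← (lintegral_alphaMuPDF_mul hαM hαMQ hμM hμQ hΩM hΩQ hz rfl).1]
      refine setLIntegral_congr_fun measurableSet_Ioi fun y hy => ?_
      have hy : 0 < y := hy
      have := alphaMuPDF_nonneg hαQ hμQ hΩQ y
      rw [ENNReal.ofReal_mul (by positivity), ENNReal.ofReal_mul hy.le]
    · rw [indicator_of_notMem (by simpa using hz), ENNReal.ofReal_zero,
        setLIntegral_eq_zero measurableSet_Ioi fun y hy => ?_]
      rw [alphaMuPDF_of_nonpos (mul_nonpos_of_nonneg_of_nonpos (le_of_lt hy) (not_lt.1 hz))]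
      simp

/-! ### The distribution function -/

/-- Integrating a term over `(0, z]` divides it by `s = θ i + β`, and `s * Γ(s) = Γ(1 + s)`. -/
theorem IsPDF.measureReal_Iic_gammaSeries {θ β : ℝ} (hθ : 0 < θ) (hβ : 0 < β) {a : ℕ → ℝ}
    (ha : EntireCoeff θ β a) {m : Measure ℝ} (h : IsPDF m (gammaSeries θ β a)) {z : ℝ}
    (hz : 0 ≤ z) :
    m.real (Iic z) = ∑' i : ℕ, a i * z ^ (θ * i + β) / Real.Gamma (1 + (θ * i + β)) := by
  have hs (i : ℕ) : 0 < θ * i + β := by positivity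
  have hG (i : ℕ) := Real.Gamma_pos_of_pos (hs i)
  set F : ℕ → ℝ → ℝ := fun i x => a i / Real.Gamma (θ * i + β) * x ^ (θ * i + β - 1) with hF
  have hpow (i : ℕ) : ∫ x in Ioc 0 z, x ^ (θ * i + β - 1) = z ^ (θ * i + β) / (θ * i + β) := by
    rw [← intervalIntegral.integral_of_le hz, integral_rpow (Or.inl (by linarith [hs i])),
      sub_add_cancel, Real.zero_rpow (hs i).ne', sub_zero]
  have hint (i : ℕ) : IntegrableOn (F i) (Ioc 0 z) :=
    ((intervalIntegral.intervalIntegrable_rpow' (by linarith [hs i])).1).const_mul _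
  have hval (i : ℕ) : ∫ x in Ioc 0 z, F i x =
      a i * z ^ (θ * i + β) / Real.Gamma (1 + (θ * i + β)) := by
    simp only [hF]
    rw [integral_const_mul, hpow, add_comm 1, Real.Gamma_add_one (hs i).ne']
    have := (hG i).ne'
    have := (hs i).ne'
    field_simp
  have hnorm (i : ℕ) : ∫ x in Ioc 0 z, ‖F i x‖ =
      |a i| * z ^ (θ * i + β) / Real.Gamma (θ * i + β) / (θ * i + β) := by
    have h1 : ∀ x ∈ Ioc 0 z, ‖F i x‖ = |a i| / Real.Gamma (θ * i + β) * x ^ (θ * i + β - 1) := by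
      intro x hx
      have h0 := hx.1
      simp only [hF]
      rw [norm_mul, norm_div, Real.norm_eq_abs, Real.norm_of_nonneg (hG i).le,
        Real.norm_of_nonneg (by positivity)]
    rw [setIntegral_congr_fun measurableSet_Ioc h1, integral_const_mul, hpow]
    ring
  have hsum : Summable fun i => ∫ x in Ioc 0 z, ‖F i x‖ := by
    simp_rw [hnorm]
    rcases hz.eq_or_lt with rfl | hz
    · simp [Real.zero_rpow (hs _).ne', summable_zero]
    -- The extra factor `1 / (θ i + β)` is at most `1 / β`.
    · refine ((ha.summable_abs β hz).mul_right β⁻¹).of_nonneg_of_le (fun i => ?_) (fun i => ?_)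
      · have := hG i
        have := hs i
        positivity
      · have := hG i
        rw [div_eq_mul_inv _ (θ * i + β)]
        gcongr
        exact le_add_of_nonneg_left (by positivity)
  have hser : ∀ x ∈ Ioc 0 z, gammaSeries θ β a x = ∑' i, F i x := by
    intro x hx
    rw [gammaSeries, indicator_of_mem (Set.mem_Ioi.2 hx.1)]
    refine tsum_congr fun i => ?_
    simp only [hF]; ring
  have key := lintegral_ofReal_eq_tsum_integral hint hsum h.1.aestronglyMeasurable
    (ae_restrict_of_forall_mem measurableSet_Ioc hser) (.of_forall h.2.1)
  have hm : m (Iic z) = ∫⁻ x in Ioc 0 z, ENNReal.ofReal (gammaSeries θ β a x) := by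
    rw [h.2.2, withDensity_apply _ measurableSet_Iic, ← lintegral_indicator measurableSet_Iic,
      ← lintegral_indicator measurableSet_Ioc]
    refine lintegral_congr fun x => ?_
    by_cases h0 : 0 < x
    · simp [indicator, h0]
    · simp [indicator, gammaSeries, h0]
  simp_rw [hval] at key
  rw [measureReal_def, hm, key.1, ENNReal.toReal_ofReal key.2]

theorem EntireCoeff.summable_cdf {θ β : ℝ} (hθ : 0 < θ) (hβ : 0 < β) {a : ℕ → ℝ}
    (ha : EntireCoeff θ β a) {z : ℝ} (hz : 0 ≤ z) :
    Summable fun i : ℕ => a i * z ^ (θ * i + β) / Real.Gamma (1 + (θ * i + β)) := by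
  have hs (i : ℕ) : 0 < θ * i + β := by positivity
  rcases hz.eq_or_lt with rfl | hz
  · simp [Real.zero_rpow (hs _).ne', summable_zero]
  · refine Summable.of_norm_bounded ((ha.summable_abs β hz).mul_right β⁻¹) fun i => ?_
    have hG := Real.Gamma_pos_of_pos (hs i)
    have := hs i
    rw [add_comm 1, Real.Gamma_add_one (hs i).ne', mul_comm (θ * i + β), ← div_div,
      div_eq_mul_inv _ (θ * i + β), norm_mul, norm_div, norm_mul, Real.norm_eq_abs,
      Real.norm_of_nonneg hG.le, Real.norm_of_nonneg (by positivity),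
      Real.norm_of_nonneg (by positivity)]
    gcongr
    exact le_add_of_nonneg_left (by positivity)

end FadingSum

namespace FadingSum

open MeasureTheory ProbabilityTheory Set Filter Topology

/-! ### The sum of finitely many independent variables -/

/-- The induction starts from a singleton, as the empty sum is a point mass at `0` and has no
density. `EntireCoeff` is carried along because the next convolution needs it. -/
theorem isPDF_finset_sum {ι S : Type*} [MeasurableSpace S] {P : Measure S}
    [IsProbabilityMeasure P] {θ : ℝ} (hθ : 0 < θ) {β : ι → ℝ} (hβ : ∀ l, 0 < β l)
    {a : ι → ℕ → ℝ} (ha : ∀ l, EntireCoeff θ (β l) (a l)) {Z : ι → S → ℝ}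
    (hZm : ∀ l, AEMeasurable (Z l) P) (hind : iIndepFun Z P)
    (hZ : ∀ l, IsPDF (P.map (Z l)) (gammaSeries θ (β l) (a l)))
    {s : Finset ι} (hs : s.Nonempty) :
    EntireCoeff θ (∑ l ∈ s, β l)
        (fun i => PowerSeries.coeff i (∏ l ∈ s, PowerSeries.mk (a l))) ∧
      IsPDF (P.map (∑ l ∈ s, Z l)) (gammaSeries θ (∑ l ∈ s, β l)
        fun i => PowerSeries.coeff i (∏ l ∈ s, PowerSeries.mk (a l))) := by
  induction hs using Finset.Nonempty.cons_induction with
  | singleton l => simpa using ⟨ha l, hZ l⟩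
  | cons l s hl hs ih =>
    have hβs : 0 < ∑ l ∈ s, β l := Finset.sum_pos (fun l _ => hβ l) hs
    have hcoeff : (fun i => PowerSeries.coeff i (∏ l ∈ Finset.cons l s hl, PowerSeries.mk (a l))) =
        cauchyProd (fun i => PowerSeries.coeff i (∏ l ∈ s, PowerSeries.mk (a l))) (a l) := by
      ext i
      rw [Finset.prod_cons, mul_comm, PowerSeries.coeff_mul, cauchyProd]
      simp only [PowerSeries.coeff_mk]
    have hindep := hind.indepFun_finsetSum_of_notMem₀ hZm hl
    have hsum : AEMeasurable (∑ l ∈ s, Z l) P := Finset.aemeasurable_sum _ fun l _ => hZm l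
    rw [hcoeff, Finset.sum_cons, Finset.sum_cons, add_comm (β l), add_comm (Z l),
      hindep.map_add_eq_map_conv_map₀ hsum (hZm l)]
    exact ⟨ih.1.cauchyProd hθ hβs (hβ l) (ha l),
      ih.2.conv_gammaSeries hθ hβs (hβ l) ih.1 (ha l) (hZ l)⟩

end FadingSum

open MeasureTheory ProbabilityTheory Filter Topology FadingSum in
theorem proposition3
    {S : Type*} [MeasurableSpace S] (P : Measure S) [IsProbabilityMeasure P]
    (L : ℕ) (hL : 1 ≤ L)
    (αM αQ : ℝ) (hαM : 0 < αM) (hαMQ : αM < αQ)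
    (μM μQ ΩM ΩQ : Fin L → ℝ)
    (hμM : ∀ l, 0 < μM l) (hμQ : ∀ l, 0 < μQ l)
    (hΩM : ∀ l, 0 < ΩM l) (hΩQ : ∀ l, 0 < ΩQ l)
    (M Q : Fin L → S → ℝ)
    (hM : ∀ l, HasLaw (M l) (alphaMuLaw αM (μM l) (ΩM l)) P)
    (hQ : ∀ l, HasLaw (Q l) (alphaMuLaw αQ (μQ l) (ΩQ l)) P)
    (hMQ : ∀ l, IndepFun (M l) (Q l) P)
    (Z : Fin L → S → ℝ) (hZ : ∀ l ω, Z l ω = M l ω / Q l ω)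
    (hind : iIndepFun Z P)
    (ϱ : Fin L → ℝ)
    (hϱ : ∀ l, ϱ l = rhoTilde αM αQ (μM l) (μQ l) (ΩM l) (ΩQ l))
    (η : Fin L → ℕ → ℝ)
    (hη : ∀ l i, η l i = u αM αQ (μM l) (μQ l) (ϱ l) i)
    (β : Fin L → ℝ) (hβ : ∀ l, β l = αM * μM l)
    (Ψ : Fin L → ℝ)
    (hΨ : ∀ l, Ψ l = αM / (Real.Gamma (μM l) * Real.Gamma (μQ l))) :
    -- the density of each ratio
    (∀ l, (∀ z, 0 < z → Summable (ratioTerm αM αQ (μM l) (μQ l) (ϱ l) z)) ∧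
      IsPDF (P.map (Z l)) ((Set.Ioi (0 : ℝ)).indicator fun z =>
        αM / (z * Real.Gamma (μM l) * Real.Gamma (μQ l))
          * ∑' i, ratioTerm αM αQ (μM l) (μQ l) (ϱ l) z i)) ∧
    -- the growth condition
    (∀ l, ∀ ε : ℝ, 0 < ε →
      Tendsto (fun i : ℕ => |η l i| / Real.Gamma (i * αM + ε)) atTop (𝓝 0)) ∧
    -- the density of the sum
    (∀ z, 0 < z → Summable (pdfTerm αM β η z)) ∧
    IsPDF (P.map fun ω => ∑ l, Z l ω) ((Set.Ioi (0 : ℝ)).indicator fun z =>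
      (∏ l, Ψ l) * ∑' i, pdfTerm αM β η z i) ∧
    -- the distribution function of the sum
    (∀ z, 0 ≤ z → Summable (cdfTerm αM β η z)) ∧
    (∀ z, 0 ≤ z →
      P.real {ω | ∑ l, Z l ω ≤ z} = (∏ l, Ψ l) * ∑' i, cdfTerm αM β η z i) := by
  have hαQ := hαM.trans hαMQ
  have hϱ0 (l) : 0 < ϱ l := hϱ l ▸ rhoTilde_pos (hμM l) (hμQ l) (hΩM l) (hΩQ l)
  have hη' (l) : η l = u αM αQ (μM l) (μQ l) (ϱ l) := funext (hη l)
  have hZ' (l) : Z l = fun ω => M l ω / Q l ω := funext (hZ l)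
  have hZm (l) : AEMeasurable (Z l) P := by
    rw [hZ']; exact (hM l).aemeasurable.div (hQ l).aemeasurable
  have hβ0 (l) : 0 < β l := by rw [hβ]; exact mul_pos hαM (hμM l)
  have hη0 (l) : η l 0 ≠ 0 := by
    rw [hη]; exact (u_zero_pos hαM hαQ (hμM l) (hμQ l) (hϱ0 l)).ne'
  have hΨ0 (l) : Ψ l ≠ 0 := by
    have := Real.Gamma_pos_of_pos (hμM l)
    have := Real.Gamma_pos_of_pos (hμQ l)
    rw [hΨ]; positivity
  have hent (l) : EntireCoeff αM (β l) (η l) := by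
    rw [hη', hβ]; exact entireCoeff_u hαM hαMQ (hμM l) (hμQ l) (hϱ0 l)
  have hratio (l) : IsPDF (P.map (Z l)) ((Set.Ioi (0 : ℝ)).indicator fun z =>
        αM / (z * Real.Gamma (μM l) * Real.Gamma (μQ l))
          * ∑' i, ratioTerm αM αQ (μM l) (μQ l) (ϱ l) z i) := by
    rw [hZ', hϱ]
    exact isPDF_ratio hαM hαMQ (hμM l) (hμQ l) (hΩM l) (hΩQ l) (hM l) (hQ l) (hMQ l)
  have hser (l) : IsPDF (P.map (Z l)) (gammaSeries αM (β l) fun i => Ψ l * η l i) := by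
    have h := hratio l
    rw [indicator_ratio_eq_gammaSeries hαM (hμM l) (hϱ0 l), ← hΨ, ← hη', ← hβ] at h
    exact h
  have : Nonempty (Fin L) := ⟨⟨0, hL⟩⟩
  have hB : 0 < ∑ l, β l := Finset.sum_pos (fun l _ => hβ0 l) Finset.univ_nonempty
  have hC : ∏ l, Ψ l ≠ 0 := Finset.prod_ne_zero_iff.2 fun l _ => hΨ0 l
  -- The constants `Ψ l` factor out of the product of power series, leaving the series whose
  -- coefficients are `delta η`.
  have hcoeff : (fun i => PowerSeries.coeff i (∏ l, PowerSeries.mk fun i => Ψ l * η l i)) =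
      fun i => (∏ l, Ψ l) * delta η i := by
    ext i
    have h (l) : (PowerSeries.mk fun i => Ψ l * η l i) =
        PowerSeries.C (Ψ l) * PowerSeries.mk (η l) := by
      ext i; simp
    simp_rw [h]
    rw [Finset.prod_mul_distrib, ← map_prod, PowerSeries.coeff_C_mul, delta_eq_coeff η hη0]
  obtain ⟨hent', hpdf⟩ := isPDF_finset_sum hαM hβ0 (fun l => (hent l).const_mul (Ψ l)) hZm hind
    hser Finset.univ_nonempty
  rw [hcoeff] at hent' hpdf
  -- Dividing by the nonzero constant `∏ l, Ψ l` transfers convergence to the bare series.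
  have hδ : EntireCoeff αM (∑ l, β l) (delta η) := by
    simpa [← mul_assoc, inv_mul_cancel₀ hC] using hent'.const_mul (∏ l, Ψ l)⁻¹
  have hpdfTerm (z : ℝ) (i : ℕ) : pdfTerm αM β η z i =
      delta η i * z ^ (αM * i + ∑ l, β l - 1) / Real.Gamma (αM * i + ∑ l, β l) := by
    rw [pdfTerm, mul_comm (i : ℝ), show -1 + αM * i + ∑ l, β l = αM * i + ∑ l, β l - 1 by ring]
  have hcdfTerm (z : ℝ) (i : ℕ) : cdfTerm αM β η z i =
      delta η i * z ^ (αM * i + ∑ l, β l) / Real.Gamma (1 + (αM * i + ∑ l, β l)) := by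
    rw [cdfTerm, mul_comm (i : ℝ), add_assoc]
  have hsumfun : (fun ω => ∑ l, Z l ω) = ∑ l, Z l := by
    ext ω; rw [Finset.sum_apply]
  refine ⟨fun l => ⟨fun z hz => summable_ratioTerm hαM hαMQ (hμM l) (hμQ l) (hϱ0 l) hz, hratio l⟩,
    fun l ε hε => ?_, fun z hz => ?_, ?_, fun z hz => ?_, fun z hz => ?_⟩
  · rw [hη']
    exact tendsto_abs_u_div_Gamma hαM hαMQ (hμM l) (hμQ l) (hϱ0 l) hε
  · refine (hδ.summable hαM hB (∑ l, β l - 1) hz).congr fun i => ?_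
    rw [hpdfTerm, add_sub_assoc]
  · rw [hsumfun]
    convert hpdf using 1
    refine Set.indicator_congr fun z _ => ?_
    rw [← tsum_mul_left]
    refine tsum_congr fun i => ?_
    rw [hpdfTerm]; ring
  · exact (hδ.summable_cdf hαM hB hz).congr fun i => (hcdfTerm z i).symm
  · have hae : AEMeasurable (∑ l, Z l) P := Finset.aemeasurable_sum _ fun l _ => hZm l
    have h := hpdf.measureReal_Iic_gammaSeries hαM hB hent' hz
    rw [map_measureReal_apply_of_aemeasurable hae measurableSet_Iic] at h
    rw [← tsum_mul_left]
    refine Eq.trans ?_ (h.trans (tsum_congr fun i => ?_))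
    · rw [← hsumfun]; rfl
    · rw [hcdfTerm]; ring
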